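/- Let $n,m,\ell,k$ be nonnegative integers, $\gamma>0$, $C\in\mathbb{R}^{n\times m}$, $A\in\mathbb{R}^{\ell\times n}$, $B\in\mathbb{R}^{\ell\times m}$, and let $\mathcal K\subseteq\mathbb{R}^{n\times m}$ be a closed convex cone (for example, a proper one) containing $0$, with dual cone $\mathcal K^\star=\{W:\langle W,X\rangle\ge 0\ \ \forall X\in\mathcal K\}$, where $\langle\cdot,\cdot\rangle$ is the Euclidean (Frobenius) inner product. For $\alpha\in\mathbb{R}^{n\times m}$ with rows $\alpha_1,\dots,\alpha_n$ put $$h(\alpha)=\sup\{\langle B,\Pi\rangle:\ \Pi\in\mathbb{R}^{\ell\times m},\ C-\alpha-A^\top\Pi\in\mathcal K^\star\}\in[-\infty,+\infty]$$ ($-\infty$ if no $\Pi$ is feasible). Let $\mathcal Y_n^k$ be the set of symmetric $P\in\mathbb{R}^{n\times n}$ with $P^2=P$ and $\operatorname{tr}P\le k$, and $\mathrm{Conv}(\mathcal Y_n^k)$ its convex hull. Then strong duality holds between the two problems below, that is, their optimal values are equal in $[-\infty,+\infty]$: $$\min_{Y\in\mathrm{Conv}(\mathcal Y_n^k)}\ \sup_{\alpha\in\mathbb{R}^{n\times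 m}}\ h(\alpha)-\frac{\gamma}{2}\sum_{i,j=1}^n Y_{ij}\langle\alpha_i,\alpha_j\rangle \;=\;\sup_{\substack{\alpha\in\mathbb{R}^{n\times m},\ U\succeq 0,\ t\ge 0\\ U+tI\succeq\frac{\gamma}{2}\alpha\alpha^\top}}\ h(\alpha)-\operatorname{tr}U-kt ,$$ and the minimum over $Y$ is attained. Moreover, for every $\alpha$ the minimum of $\operatorname{tr}U+kt$ over $U\succeq0$, $t\ge0$ with $U+tI\succeq\frac{\gamma}{2}\alpha\alpha^\top$ is attained and equals the sum $\Sigma_k(\alpha)$ of the $k$ largest eigenvalues of $\frac{\gamma}{2}\alpha\alpha^\top$ (of all eigenvalues if $k>n$), so that the common value is also $\sup_{\alpha}\,[h(\alpha)-\Sigma_k(\alpha)]$. In particular all this holds when each subproblem $\min\{\langle C,X\rangle+\frac1{2\gamma}\|X\|_F^2: AX=B,\ X\in\mathcal K,\ X=YX\}$, $Y\in\mathcal Y_n^k$, is infeasible or satisfies strong duality. -/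

import Mathlib

noncomputable section

/-- The Euclidean (Frobenius) inner product of two real matrices of the same size. -/
def frobInner {p q : ℕ} (X Y : Matrix (Fin p) (Fin q) ℝ) : ℝ :=
  ∑ i, ∑ j, X i j * Y i j

/-- The `n × n` orthogonal projection matrices with trace (that is, rank) at most `k`. -/
def projectionMatrices (n k : ℕ) : Set (Matrix (Fin n) (Fin n) ℝ) :=
  {P | P.IsSymm ∧ P * P = P ∧ P.trace ≤ (k : ℝ)}

/-- The dual cone with respect to the Frobenius inner product. -/
def frobDualCone {n m : ℕ} (K : ProperCone ℝ (Matrix (Fin n) (Fin m) ℝ)) :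
    Set (Matrix (Fin n) (Fin m) ℝ) :=
  {W | ∀ X ∈ K, 0 ≤ frobInner W X}

/-- The concave function `h(α) = sup {⟨B, Q⟩ : C - α - Aᵀ Q ∈ K*}`, with values in the extended
reals; it is `-∞` where no `Q` is feasible. -/
def dualConjugate {n m l : ℕ} (C : Matrix (Fin n) (Fin m) ℝ) (A : Matrix (Fin l) (Fin n) ℝ)
    (B : Matrix (Fin l) (Fin m) ℝ) (K : ProperCone ℝ (Matrix (Fin n) (Fin m) ℝ))
    (α : Matrix (Fin n) (Fin m) ℝ) : EReal :=
  ⨆ (Q : Matrix (Fin l) (Fin m) ℝ) (_ : C - α - A.transpose * Q ∈ frobDualCone K),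
    ((frobInner B Q : ℝ) : EReal)

/-- The inner maximum of the saddle-point relaxation at `Y`:
`sup_α h(α) - (γ/2) ∑ i j, Y i j ⟨α_i, α_j⟩`, where `α_i` is the `i`-th row of `α`. -/
def innerMax {n m l : ℕ} (C : Matrix (Fin n) (Fin m) ℝ) (A : Matrix (Fin l) (Fin n) ℝ)
    (B : Matrix (Fin l) (Fin m) ℝ) (K : ProperCone ℝ (Matrix (Fin n) (Fin m) ℝ)) (γ : ℝ)
    (Y : Matrix (Fin n) (Fin n) ℝ) : EReal :=
  ⨆ α : Matrix (Fin n) (Fin m) ℝ,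
    dualConjugate C A B K α -
      ((γ / 2 * ∑ i, ∑ j, Y i j * (α i ⬝ᵥ α j) : ℝ) : EReal)

/-- The matrix `(γ/2) α αᵀ`. -/
def scaledGram {n m : ℕ} (γ : ℝ) (α : Matrix (Fin n) (Fin m) ℝ) : Matrix (Fin n) (Fin n) ℝ :=
  (γ / 2) • (α * α.transpose)

theorem scaledGram_isHermitian {n m : ℕ} (γ : ℝ) (α : Matrix (Fin n) (Fin m) ℝ) :
    (scaledGram γ α).IsHermitian := by
  unfold scaledGram Matrix.IsHermitian
  rw [Matrix.conjTranspose_eq_transpose_of_trivial, Matrix.transpose_smul,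
    Matrix.transpose_mul, Matrix.transpose_transpose]

/-- Feasibility of `(U, t)` at `α`: `U ⪰ 0`, `t ≥ 0` and `U + t I ⪰ (γ/2) α αᵀ`. -/
def SDPFeasible {n m : ℕ} (γ : ℝ) (α : Matrix (Fin n) (Fin m) ℝ)
    (U : Matrix (Fin n) (Fin n) ℝ) (t : ℝ) : Prop :=
  U.PosSemidef ∧ 0 ≤ t ∧
    (U + t • (1 : Matrix (Fin n) (Fin n) ℝ) - scaledGram γ α).PosSemidef

/-- The optimal value of the maximization of `h(α) - tr U - k t` over all `α` and all `(U, t)`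
feasible at `α`. -/
def sdpValue {n m l : ℕ} (C : Matrix (Fin n) (Fin m) ℝ) (A : Matrix (Fin l) (Fin n) ℝ)
    (B : Matrix (Fin l) (Fin m) ℝ) (K : ProperCone ℝ (Matrix (Fin n) (Fin m) ℝ)) (γ : ℝ)
    (k : ℕ) : EReal :=
  ⨆ (α : Matrix (Fin n) (Fin m) ℝ) (U : Matrix (Fin n) (Fin n) ℝ) (t : ℝ)
    (_ : SDPFeasible γ α U t),
    dualConjugate C A B K α - ((U.trace + (k : ℝ) * t : ℝ) : EReal)

/-- The sum of the `k` largest eigenvalues of a Hermitian matrix, counted with multiplicity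
(`eigenvalues₀` lists them in decreasing order); all of them if `k` exceeds the size. -/
def sumLargestEigenvalues {n : ℕ} {S : Matrix (Fin n) (Fin n) ℝ} (hS : S.IsHermitian)
    (k : ℕ) : ℝ :=
  ∑ i with i.val < k, hS.eigenvalues₀ i

end

/-! Unfolding `h` merges `α` and its multiplier `Q` into one variable `x` in a convex set. The
saddle function is affine in `Y` and concave in `x`, since `tr (Y α αᵀ)` is a convex combination of
squared norms `‖P α‖²` with `P` a projection. As `Y` ranges over a compact convex set, Sion's
theorem exchanges min and sup (`isLeast_innerMax`). For fixed `α`, the minimum over `Y` is governed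
by Ky Fan's principle, and the problem in `(U, t)` is its dual: weak duality is
`trace_projection_mul_le`, and equality comes from cutting the spectrum at a threshold eigenvalue
(`exists_feasible_trace_eq`). -/

/-! ### Compact convex hulls and extended-real suprema. -/

/-- In a finite-dimensional real topological vector space, the convex hull of a compact set is
compact. -/
theorem IsCompact.convexHull_of_finiteDimensional {E : Type*} [AddCommGroup E] [Module ℝ E]
    [TopologicalSpace E] [IsTopologicalAddGroup E] [ContinuousSMul ℝ E] [FiniteDimensional ℝ E]
    {s : Set E} (hs : IsCompact s) : IsCompact (convexHull ℝ s) := by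
  -- Carathéodory: `finrank + 1` points suffice, so the hull is a finite union of continuous images
  -- of compact sets.
  have key : convexHull ℝ s =
      ⋃ c ∈ Set.Iic (Module.finrank ℝ E + 1),
        (fun p : (Fin c → ℝ) × (Fin c → E) => ∑ i, p.1 i • p.2 i) ''
          (stdSimplex ℝ (Fin c) ×ˢ Set.univ.pi fun _ => s) := by
    apply Set.Subset.antisymm
    · intro x hx
      obtain ⟨ι, _, z, w, hz, hind, hw, hw1, hx⟩ := eq_pos_convex_span_of_mem_convexHull hx
      have hcard : Fintype.card ι ≤ Module.finrank ℝ E + 1 :=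
        hind.card_le_finrank_succ.trans (by gcongr; exact Submodule.finrank_le _)
      let e := (Fintype.equivFin ι).symm
      refine Set.mem_biUnion (x := Fintype.card ι) hcard
        ⟨(w ∘ e, z ∘ e), ⟨⟨fun i => (hw _).le, ?_⟩, fun i _ => hz ⟨_, rfl⟩⟩, ?_⟩
      · rw [← hw1]
        exact e.sum_comp w
      · rw [← hx]
        exact e.sum_comp fun i => w i • z i
    · simp only [Set.iUnion_subset_iff]
      rintro c - _ ⟨⟨w, z⟩, ⟨⟨hw, hw1⟩, hz⟩, rfl⟩
      exact (convex_convexHull ℝ s).sum_mem (fun i _ => hw i) hw1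
        fun i _ => subset_convexHull ℝ s (hz i trivial)
  rw [key]
  refine (Set.finite_Iic _).isCompact_biUnion fun c _ => IsCompact.image ?_ (by fun_prop)
  exact (isCompact_stdSimplex ℝ (Fin c)).prod (isCompact_univ_pi fun _ => hs)

/-- Both sides have the same upper bounds. An empty index is allowed, which covers `α` with no
feasible `Q`. -/
theorem EReal.iSup_sub_coe {ι : Sort*} (f : ι → EReal) (c : ℝ) :
    (⨆ i, f i) - (c : EReal) = ⨆ i, (f i - (c : EReal)) := by
  refine eq_of_forall_ge_iff fun u => ?_
  simp only [iSup_le_iff, EReal.sub_le_iff_le_add (Or.inl (EReal.coe_ne_bot c))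
    (Or.inl (EReal.coe_ne_top c))]

/-! ### Functional calculus in an eigenbasis of `S`. -/

namespace Matrix

variable {n : Type*} [Fintype n]

/-- The trace of the product of a positive semidefinite matrix and an orthogonal projection is
nonnegative. -/
theorem PosSemidef.trace_mul_projection_nonneg {P Q : Matrix n n ℝ}
    (hQ : Q.PosSemidef) (hP : P.IsSymm) (hPP : P * P = P) : 0 ≤ (P * Q).trace := by
  -- `tr (P Q) = tr (P Q P)`, because `P` is idempotent.
  have h := (hQ.mul_mul_conjTranspose_same P).trace_nonneg
  rwa [conjTranspose_eq_transpose_of_trivial, hP.eq, trace_mul_comm, ← mul_assoc, hPP] at h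

namespace IsHermitian

variable [DecidableEq n] {S : Matrix n n ℝ} (hS : S.IsHermitian)

/-- The matrix with the eigenvectors of `S` and the prescribed eigenvalues `f`. -/
noncomputable def spectralMatrix (f : n → ℝ) : Matrix n n ℝ :=
  (hS.eigenvectorUnitary : Matrix n n ℝ) * diagonal f *
    (hS.eigenvectorUnitary : Matrix n n ℝ)ᴴ

theorem conjTranspose_mul_eigenvectorUnitary :
    (hS.eigenvectorUnitary : Matrix n n ℝ)ᴴ * hS.eigenvectorUnitary = 1 :=
  Unitary.coe_star_mul_self hS.eigenvectorUnitary

theorem spectralMatrix_eigenvalues : hS.spectralMatrix hS.eigenvalues = S :=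
  hS.spectral_theorem.symm

theorem spectralMatrix_const (c : ℝ) : hS.spectralMatrix (fun _ => c) = c • 1 := by
  have h : (hS.eigenvectorUnitary : Matrix n n ℝ) * (hS.eigenvectorUnitary : Matrix n n ℝ)ᴴ = 1 :=
    Unitary.coe_mul_star_self hS.eigenvectorUnitary
  rw [spectralMatrix, ← smul_one_eq_diagonal, Matrix.mul_smul, mul_one,
    Matrix.smul_mul, h]

theorem spectralMatrix_mul (f g : n → ℝ) :
    hS.spectralMatrix f * hS.spectralMatrix g = hS.spectralMatrix (f * g) := by
  have h := hS.conjTranspose_mul_eigenvectorUnitary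
  simp only [spectralMatrix]
  rw [mul_assoc, mul_assoc, mul_assoc, ← mul_assoc _ᴴ, h, one_mul,
    ← mul_assoc (diagonal f), diagonal_mul_diagonal, mul_assoc]
  rfl

theorem spectralMatrix_add (f g : n → ℝ) :
    hS.spectralMatrix (f + g) = hS.spectralMatrix f + hS.spectralMatrix g := by
  simp only [spectralMatrix, ← add_mul, ← mul_add, diagonal_add]
  rfl

theorem spectralMatrix_sub (f g : n → ℝ) :
    hS.spectralMatrix (f - g) = hS.spectralMatrix f - hS.spectralMatrix g := by
  simp only [spectralMatrix, ← sub_mul, ← mul_sub, diagonal_sub]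
  rfl

theorem trace_spectralMatrix (f : n → ℝ) : (hS.spectralMatrix f).trace = ∑ i, f i := by
  rw [spectralMatrix, trace_mul_comm, ← mul_assoc, hS.conjTranspose_mul_eigenvectorUnitary,
    one_mul, trace_diagonal]

theorem isSymm_spectralMatrix (f : n → ℝ) : (hS.spectralMatrix f).IsSymm := by
  simp only [spectralMatrix, IsSymm, conjTranspose_eq_transpose_of_trivial, transpose_mul,
    transpose_transpose, diagonal_transpose, mul_assoc]

theorem posSemidef_spectralMatrix {f : n → ℝ} (hf : 0 ≤ f) : (hS.spectralMatrix f).PosSemidef :=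
  (PosSemidef.diagonal hf).mul_mul_conjTranspose_same _

end IsHermitian
end Matrix

/-! ### Ky Fan's principle and its semidefinite dual. -/

section KyFan

variable {n : ℕ} {S : Matrix (Fin n) (Fin n) ℝ} (hS : S.IsHermitian) (k : ℕ)

/-- The indices of the `k` largest eigenvalues. -/
noncomputable def topIndices (n k : ℕ) : Finset (Fin n) :=
  {i | ((Fintype.equivOfCardEq (Fintype.card_fin (Fintype.card (Fin n)))).symm i).val < k}

theorem card_topIndices : (topIndices n k).card = min k n := by
  have h : (topIndices n k).card =
      (Finset.univ.filter fun i : Fin (Fintype.card (Fin n)) => i.val < k).card := by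
    refine Finset.card_equiv
      (Fintype.equivOfCardEq (Fintype.card_fin (Fintype.card (Fin n)))).symm fun i => ?_
    simp [topIndices]
  rw [h, Fin.card_filter_val_lt, Fintype.card_fin, min_comm]

/-- `eigenvalues` is `eigenvalues₀` reindexed along the very equivalence used in `topIndices`. -/
theorem sum_topIndices :
    ∑ i ∈ topIndices n k, hS.eigenvalues i = sumLargestEigenvalues hS k := by
  refine Finset.sum_equiv
    (Fintype.equivOfCardEq (Fintype.card_fin (Fintype.card (Fin n)))).symm (fun i => ?_)
    fun i _ => rfl
  simp [topIndices]

/-- The projection onto the span of the top eigenvectors. -/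
theorem exists_projection_trace_mul_eq :
    ∃ P ∈ projectionMatrices n k, (P * S).trace = sumLargestEigenvalues hS k := by
  let f : Fin n → ℝ := fun i => if i ∈ topIndices n k then 1 else 0
  refine ⟨hS.spectralMatrix f, ⟨hS.isSymm_spectralMatrix f, ?_, ?_⟩, ?_⟩
  · rw [hS.spectralMatrix_mul]
    congr 1
    ext i
    simp [f]
  · rw [hS.trace_spectralMatrix]
    simp [f, card_topIndices]
  · nth_rw 2 [← hS.spectralMatrix_eigenvalues]
    rw [hS.spectralMatrix_mul, hS.trace_spectralMatrix, ← sum_topIndices]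
    simp [f]

/-- Counting from zero, `t` is eigenvalue number `k`, or `0` if there is none. The last clause makes
`k * t` harmless when fewer than `k` eigenvalues exist. -/
theorem exists_threshold (h0 : S.PosSemidef) : ∃ t : ℝ, 0 ≤ t ∧
    (∀ i ∈ topIndices n k, t ≤ hS.eigenvalues i) ∧
    (∀ i ∉ topIndices n k, hS.eigenvalues i ≤ t) ∧ (n < k → t = 0) := by
  by_cases hk : k < n
  · have hk' : k < Fintype.card (Fin n) := by simpa using hk
    refine ⟨hS.eigenvalues₀ ⟨k, hk'⟩, ?_, fun i hi => ?_, fun i hi => ?_, fun h => by omega⟩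
    · have := h0.eigenvalues_nonneg
        ((Fintype.equivOfCardEq (Fintype.card_fin (Fintype.card (Fin n)))) ⟨k, hk'⟩)
      simpa [Matrix.IsHermitian.eigenvalues] using this
    · simp only [topIndices, Finset.mem_filter, Finset.mem_univ, true_and] at hi
      exact hS.eigenvalues₀_antitone (Fin.mk_le_mk.2 hi.le)
    · simp only [topIndices, Finset.mem_filter, Finset.mem_univ, true_and, not_lt] at hi
      exact hS.eigenvalues₀_antitone (Fin.mk_le_mk.2 hi)
  · refine ⟨0, le_rfl, fun i _ => h0.eigenvalues_nonneg i, fun i hi => ?_, fun _ => rfl⟩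
    refine absurd ?_ hi
    have : topIndices n k = Finset.univ := by
      rw [← Finset.card_eq_iff_eq_univ, card_topIndices, Fintype.card_fin]
      omega
    simp [this]

theorem exists_feasible_trace_eq (h0 : S.PosSemidef) :
    ∃ (U : Matrix (Fin n) (Fin n) ℝ) (t : ℝ), U.PosSemidef ∧ 0 ≤ t ∧
      (U + t • (1 : Matrix (Fin n) (Fin n) ℝ) - S).PosSemidef ∧
      U.trace + k * t = sumLargestEigenvalues hS k := by
  obtain ⟨t, ht, h1, h2, h3⟩ := exists_threshold hS k h0
  -- `U` is the positive part of `S - t I`.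
  let f : Fin n → ℝ := fun i => if i ∈ topIndices n k then hS.eigenvalues i - t else 0
  refine ⟨hS.spectralMatrix f, t, hS.posSemidef_spectralMatrix fun i => ?_, ht, ?_, ?_⟩
  · by_cases hi : i ∈ topIndices n k
    · simpa [f, hi] using h1 i hi
    · simp [f, hi]
  · nth_rw 2 [← hS.spectralMatrix_eigenvalues]
    rw [← hS.spectralMatrix_const, ← hS.spectralMatrix_add, ← hS.spectralMatrix_sub]
    refine hS.posSemidef_spectralMatrix fun i => ?_
    by_cases hi : i ∈ topIndices n k
    · simp [f, hi]
    · simpa [f, hi] using h2 i hi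
  · rw [hS.trace_spectralMatrix, ← sum_topIndices]
    simp only [f, Finset.sum_ite_mem, Finset.univ_inter, Finset.sum_sub_distrib,
      Finset.sum_const, card_topIndices, nsmul_eq_mul]
    rcases le_or_gt k n with h | h
    · rw [min_eq_left h]
      ring
    · rw [h3 h]
      ring

/-- The gap is `tr (P (U + t I - S)) + tr ((1 - P) U) + t (k - tr P)`, a sum of nonnegative terms.
-/
theorem trace_projection_mul_le {P U : Matrix (Fin n) (Fin n) ℝ} {t : ℝ}
    (hP : P ∈ projectionMatrices n k) (hU : U.PosSemidef) (ht : 0 ≤ t)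
    (h : (U + t • (1 : Matrix (Fin n) (Fin n) ℝ) - S).PosSemidef) :
    (P * S).trace ≤ U.trace + k * t := by
  obtain ⟨hs, hp, hk⟩ := hP
  have h1 := h.trace_mul_projection_nonneg hs hp
  have h2 := hU.trace_mul_projection_nonneg (P := 1 - P)
    (by simp [Matrix.IsSymm, hs.eq]) (by simp [mul_sub, sub_mul, hp])
  simp only [mul_sub, sub_mul, mul_add, Matrix.trace_sub, Matrix.trace_add, Matrix.mul_smul,
    mul_one, one_mul, Matrix.trace_smul, smul_eq_mul] at h1 h2
  nlinarith [mul_le_mul_of_nonneg_left hk ht]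

theorem isLeast_sumLargestEigenvalues (h0 : S.PosSemidef) :
    IsLeast {v : ℝ | ∃ (U : Matrix (Fin n) (Fin n) ℝ) (t : ℝ), (U.PosSemidef ∧ 0 ≤ t ∧
      (U + t • (1 : Matrix (Fin n) (Fin n) ℝ) - S).PosSemidef) ∧ v = U.trace + k * t}
      (sumLargestEigenvalues hS k) := by
  constructor
  · obtain ⟨U, t, hU, ht, h, he⟩ := exists_feasible_trace_eq hS k h0
    exact ⟨U, t, ⟨hU, ht, h⟩, he.symm⟩
  · rintro _ ⟨U, t, ⟨hU, ht, h⟩, rfl⟩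
    obtain ⟨P, hP, he⟩ := exists_projection_trace_mul_eq hS k
    exact he ▸ trace_projection_mul_le k hP hU ht h

/-- **Ky Fan's maximum principle**. -/
theorem isGreatest_trace_mul_convexHull_projectionMatrices (h0 : S.PosSemidef) :
    IsGreatest ((fun Y => (Y * S).trace) '' convexHull ℝ (projectionMatrices n k))
      (sumLargestEigenvalues hS k) := by
  constructor
  · obtain ⟨P, hP, he⟩ := exists_projection_trace_mul_eq hS k
    exact ⟨P, subset_convexHull ℝ _ hP, he⟩
  · rintro _ ⟨Y, hY, rfl⟩
    obtain ⟨U, t, hU, ht, h, he⟩ := exists_feasible_trace_eq hS k h0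
    -- A linear bound valid on the projections persists on their hull.
    refine convexHull_min (t := {Y | (Y * S).trace ≤ sumLargestEigenvalues hS k})
      (fun P hP => he ▸ trace_projection_mul_le k hP hU ht h) ?_ hY
    refine convex_halfSpace_le (f := fun Y : Matrix (Fin n) (Fin n) ℝ => (Y * S).trace)
      ⟨fun X Y => ?_, fun c X => ?_⟩ _
    · simp [add_mul]
    · simp

end KyFan

/-! ### Compactness of the projections and convexity of the penalty. -/

theorem convexOn_finset_sum {E ι : Type*} [AddCommGroup E] [Module ℝ E] {s : Set E}
    (t : Finset ι) (hs : Convex ℝ s) {f : ι → E → ℝ} (hf : ∀ i, ConvexOn ℝ s (f i)) :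
    ConvexOn ℝ s fun x => ∑ i ∈ t, f i x := by
  classical
  induction t using Finset.induction_on with
  | empty => simpa using convexOn_const 0 hs
  | insert i t hi ih =>
    simp only [Finset.sum_insert hi]
    exact (hf i).add ih

theorem isCompact_projectionMatrices (n k : ℕ) : IsCompact (projectionMatrices n k) := by
  have hbox : IsCompact (Set.univ.pi fun _ => Set.univ.pi fun _ => Set.Icc (-1) 1 :
      Set (Matrix (Fin n) (Fin n) ℝ)) :=
    isCompact_univ_pi fun _ => isCompact_univ_pi fun _ => isCompact_Icc
  refine hbox.of_isClosed_subset ?_ ?_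
  · refine (isClosed_eq (by fun_prop) (by fun_prop)).inter
      ((isClosed_eq (by fun_prop) (by fun_prop)).inter
        (isClosed_le (continuous_id.matrix_trace) continuous_const))
  · rintro (P : Matrix (Fin n) (Fin n) ℝ) ⟨hs, hp, -⟩ i - j -
    have hdiag : P i i = ∑ j, P i j ^ 2 := by
      calc P i i = (P * P) i i := by rw [hp]
        _ = ∑ j, P i j * P j i := Matrix.mul_apply
        _ = ∑ j, P i j ^ 2 := Finset.sum_congr rfl fun j _ => by rw [sq, hs.apply]
    have hle (j) : P i j ^ 2 ≤ P i i := by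
      rw [hdiag]
      exact Finset.single_le_sum (f := fun j => P i j ^ 2) (fun j _ => sq_nonneg _)
        (Finset.mem_univ j)
    rw [Set.mem_Icc, ← abs_le, ← sq_le_one_iff_abs_le_one]
    -- `P i i ^ 2 ≤ P i i` forces `P i i ≤ 1`, hence `P i j ^ 2 ≤ 1`.
    nlinarith [hle i, hle j]

theorem zero_mem_projectionMatrices (n k : ℕ) : 0 ∈ projectionMatrices n k := by
  simp [projectionMatrices, Matrix.IsSymm]

theorem posSemidef_scaledGram {n m : ℕ} {γ : ℝ} (hγ : 0 ≤ γ) (α : Matrix (Fin n) (Fin m) ℝ) :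
    (scaledGram γ α).PosSemidef := by
  have h := Matrix.posSemidef_self_mul_conjTranspose α
  rw [Matrix.conjTranspose_eq_transpose_of_trivial] at h
  exact h.smul (by positivity)

theorem trace_mul_scaledGram {n m : ℕ} (γ : ℝ) (Y : Matrix (Fin n) (Fin n) ℝ)
    (α : Matrix (Fin n) (Fin m) ℝ) :
    (Y * scaledGram γ α).trace = γ / 2 * ∑ i, ∑ j, Y i j * (α i ⬝ᵥ α j) := by
  rw [scaledGram, Matrix.mul_smul, Matrix.trace_smul, smul_eq_mul]
  congr 1
  refine Finset.sum_congr rfl fun i _ => Matrix.mul_apply.trans ?_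
  refine Finset.sum_congr rfl fun j _ => ?_
  rw [dotProduct_comm]
  rfl

/-- Since `P = Pᵀ = P²`, the trace is `γ / 2` times the sum of squared entries of `P α`. -/
theorem convexOn_trace_projection_mul_scaledGram {n m k : ℕ} {γ : ℝ} (hγ : 0 ≤ γ)
    {P : Matrix (Fin n) (Fin n) ℝ} (hP : P ∈ projectionMatrices n k) :
    ConvexOn ℝ Set.univ fun α : Matrix (Fin n) (Fin m) ℝ => (P * scaledGram γ α).trace := by
  obtain ⟨hs, hp, -⟩ := hP
  have h (α : Matrix (Fin n) (Fin m) ℝ) :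
      (P * scaledGram γ α).trace = γ / 2 * ∑ i, ∑ j, (P * α) i j ^ 2 := by
    have h1 : (P * (α * α.transpose)).trace = ((P * α) * (P * α).transpose).trace := by
      rw [Matrix.transpose_mul, hs.eq, ← Matrix.mul_assoc (P * α), Matrix.trace_mul_comm (_ * _) P,
        Matrix.mul_assoc P α, ← Matrix.mul_assoc P P, hp]
    rw [scaledGram, Matrix.mul_smul, Matrix.trace_smul, smul_eq_mul, h1]
    congr 1
    refine Finset.sum_congr rfl fun i _ => Matrix.mul_apply.trans ?_
    exact Finset.sum_congr rfl fun j _ => (sq _).symm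
  simp only [h]
  refine ConvexOn.smul (by positivity : (0 : ℝ) ≤ γ / 2) ?_
  refine convexOn_finset_sum _ convex_univ fun i => convexOn_finset_sum _ convex_univ fun j => ?_
  exact (even_two.convexOn_pow (𝕜 := ℝ)).comp_linearMap
    (Matrix.entryLinearMap ℝ ℝ i j ∘ₗ mulLeftLinearMap (Fin m) ℝ P)

theorem convexOn_trace_mul_scaledGram {n m k : ℕ} {γ : ℝ} (hγ : 0 ≤ γ)
    {Y : Matrix (Fin n) (Fin n) ℝ} (hY : Y ∈ convexHull ℝ (projectionMatrices n k)) :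
    ConvexOn ℝ Set.univ fun α : Matrix (Fin n) (Fin m) ℝ => (Y * scaledGram γ α).trace := by
  let T : Set (Matrix (Fin n) (Fin n) ℝ) := {Y | ConvexOn ℝ Set.univ
    fun α : Matrix (Fin n) (Fin m) ℝ => (Y * scaledGram γ α).trace}
  have hT (Y) : Y ∈ T ↔ ConvexOn ℝ Set.univ
    fun α : Matrix (Fin n) (Fin m) ℝ => (Y * scaledGram γ α).trace := Iff.rfl
  refine (hT Y).1 (convexHull_min
    (fun P hP => (hT P).2 (convexOn_trace_projection_mul_scaledGram hγ hP)) ?_ hY)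
  intro X hX Z hZ a b ha hb _
  refine (hT _).2 (((((hT X).1 hX).smul ha).add (((hT Z).1 hZ).smul hb)).congr fun α _ => ?_)
  simp [add_mul]

/-! ### The saddle function and Sion's exchange. -/

section Minimax

variable {n m l : ℕ} (C : Matrix (Fin n) (Fin m) ℝ) (A : Matrix (Fin l) (Fin n) ℝ)
  (B : Matrix (Fin l) (Fin m) ℝ) (K : ProperCone ℝ (Matrix (Fin n) (Fin m) ℝ)) (γ : ℝ) (k : ℕ)

/-- The pairs `(α, Q)` with `C - α - Aᵀ Q ∈ K*`. -/
def dualFeasibleSet : Set (Matrix (Fin n) (Fin m) ℝ × Matrix (Fin l) (Fin m) ℝ) :=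
  {x | C - x.1 - A.transpose * x.2 ∈ frobDualCone K}

/-- The saddle function `⟨B, Q⟩ - tr (Y (γ/2) α αᵀ)`. -/
noncomputable def saddleFunction (Y : Matrix (Fin n) (Fin n) ℝ)
    (x : Matrix (Fin n) (Fin m) ℝ × Matrix (Fin l) (Fin m) ℝ) : ℝ :=
  frobInner B x.2 - (Y * scaledGram γ x.1).trace

theorem isLinearMap_frobInner {p q : ℕ} (W : Matrix (Fin p) (Fin q) ℝ) :
    IsLinearMap ℝ (frobInner W) where
  map_add X Y := by simp [frobInner, mul_add, Finset.sum_add_distrib]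
  map_smul c X := by simp [frobInner, Finset.mul_sum, mul_left_comm]

theorem frobInner_comm {p q : ℕ} (X Y : Matrix (Fin p) (Fin q) ℝ) :
    frobInner X Y = frobInner Y X := by
  simp only [frobInner, mul_comm]

theorem convex_frobDualCone : Convex ℝ (frobDualCone K) := by
  intro V hV W hW a b ha hb _ X hX
  rw [frobInner_comm, (isLinearMap_frobInner X).map_add, (isLinearMap_frobInner X).map_smul,
    (isLinearMap_frobInner X).map_smul, frobInner_comm X, frobInner_comm X]
  exact add_nonneg (mul_nonneg ha (hV X hX)) (mul_nonneg hb (hW X hX))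

theorem convex_dualFeasibleSet : Convex ℝ (dualFeasibleSet C A K) := by
  intro x hx y hy a b ha hb hab
  have h := convex_frobDualCone K hx hy ha hb hab
  have e : a • (C - x.1 - A.transpose * x.2) + b • (C - y.1 - A.transpose * y.2) =
      C - (a • x + b • y).1 - A.transpose * (a • x + b • y).2 := by
    nth_rw 3 [← one_smul ℝ C]
    rw [← hab]
    simp only [Prod.fst_add, Prod.smul_fst, Prod.snd_add, Prod.smul_snd, Matrix.mul_add,
      Matrix.mul_smul, smul_sub, add_smul]
    abel
  rwa [e] at h

theorem innerMax_eq_iSup_saddleFunction (Y : Matrix (Fin n) (Fin n) ℝ) :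
    innerMax C A B K γ Y =
      ⨆ x ∈ dualFeasibleSet C A K, (saddleFunction B γ Y x : EReal) := by
  simp only [innerMax, dualConjugate, EReal.iSup_sub_coe, iSup_prod, saddleFunction,
    trace_mul_scaledGram, EReal.coe_sub]
  rfl

theorem iSup_dualConjugate_sub (σ : Matrix (Fin n) (Fin m) ℝ → ℝ) :
    ⨆ α, (dualConjugate C A B K α - (σ α : EReal)) =
      ⨆ x ∈ dualFeasibleSet C A K, ((frobInner B x.2 - σ x.1 : ℝ) : EReal) := by
  simp only [dualConjugate, EReal.iSup_sub_coe, iSup_prod, EReal.coe_sub]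
  rfl

theorem isLeast_saddleFunction (hγ : 0 ≤ γ)
    (x : Matrix (Fin n) (Fin m) ℝ × Matrix (Fin l) (Fin m) ℝ) :
    IsLeast ((fun Y => (saddleFunction B γ Y x : EReal)) ''
      convexHull ℝ (projectionMatrices n k))
      ((frobInner B x.2 - sumLargestEigenvalues (scaledGram_isHermitian γ x.1) k : ℝ) : EReal) := by
  obtain ⟨⟨Y, hY, he⟩, hle⟩ := isGreatest_trace_mul_convexHull_projectionMatrices
    (scaledGram_isHermitian γ x.1) k (posSemidef_scaledGram hγ x.1)
  refine ⟨⟨Y, hY, ?_⟩, ?_⟩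
  · simp only [saddleFunction, ← he]
  · rintro _ ⟨Z, hZ, rfl⟩
    exact EReal.coe_le_coe_iff.2 (sub_le_sub_left (hle ⟨Z, hZ, rfl⟩) _)

theorem continuous_saddleFunction_left
    (x : Matrix (Fin n) (Fin m) ℝ × Matrix (Fin l) (Fin m) ℝ) :
    Continuous fun Y => (saddleFunction B γ Y x : EReal) := by
  refine continuous_coe_real_ereal.comp (continuous_const.sub ?_)
  exact Continuous.matrix_trace (by fun_prop)

theorem continuous_saddleFunction_right (Y : Matrix (Fin n) (Fin n) ℝ) :
    Continuous fun x : Matrix (Fin n) (Fin m) ℝ × Matrix (Fin l) (Fin m) ℝ =>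
      (saddleFunction B γ Y x : EReal) := by
  refine continuous_coe_real_ereal.comp (Continuous.sub ?_ (Continuous.matrix_trace ?_))
  · unfold frobInner
    fun_prop
  · unfold scaledGram
    fun_prop

theorem quasiconvexOn_saddleFunction
    (x : Matrix (Fin n) (Fin m) ℝ × Matrix (Fin l) (Fin m) ℝ) :
    QuasiconvexOn ℝ (convexHull ℝ (projectionMatrices n k))
      fun Y => (saddleFunction B γ Y x : EReal) := by
  refine QuasiconvexOn.monotone_comp (g := Real.toEReal) EReal.coe_strictMono.monotone
    (ConvexOn.quasiconvexOn ⟨convex_convexHull ℝ _, ?_⟩)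
  intro Y _ Z _ a b _ _ hab
  refine le_of_eq ?_
  simp only [saddleFunction, add_mul, Matrix.trace_add, Matrix.smul_mul, Matrix.trace_smul,
    smul_eq_mul]
  linear_combination (-frobInner B x.2) * hab

theorem quasiconcaveOn_saddleFunction (hγ : 0 ≤ γ) {Y : Matrix (Fin n) (Fin n) ℝ}
    (hY : Y ∈ convexHull ℝ (projectionMatrices n k)) :
    QuasiconcaveOn ℝ (dualFeasibleSet C A K) fun x => (saddleFunction B γ Y x : EReal) := by
  refine QuasiconcaveOn.monotone_comp (g := Real.toEReal) EReal.coe_strictMono.monotone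
    (ConcaveOn.quasiconcaveOn ?_)
  have h1 : ConcaveOn ℝ Set.univ
      fun x : Matrix (Fin n) (Fin m) ℝ × Matrix (Fin l) (Fin m) ℝ => frobInner B x.2 :=
    ((isLinearMap_frobInner B).mk' _ ∘ₗ LinearMap.snd ℝ _ _).concaveOn convex_univ
  have h2 := (convexOn_trace_mul_scaledGram (m := m) hγ hY).comp_linearMap
    (LinearMap.fst ℝ _ (Matrix (Fin l) (Fin m) ℝ))
  exact (h1.sub h2).subset (Set.subset_univ _) (convex_dualFeasibleSet C A K)

theorem isLeast_innerMax (hγ : 0 ≤ γ) :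
    IsLeast (innerMax C A B K γ '' convexHull ℝ (projectionMatrices n k))
      (⨆ α, (dualConjugate C A B K α -
        (sumLargestEigenvalues (scaledGram_isHermitian γ α) k : EReal))) := by
  have hcompact := (isCompact_projectionMatrices n k).convexHull_of_finiteDimensional
  have hne : (convexHull ℝ (projectionMatrices n k)).Nonempty :=
    ⟨0, subset_convexHull ℝ _ (zero_mem_projectionMatrices n k)⟩
  have hfun : innerMax C A B K γ =
      fun Y => ⨆ x ∈ dualFeasibleSet C A K, (saddleFunction B γ Y x : EReal) :=
    funext (innerMax_eq_iSup_saddleFunction C A B K γ)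
  -- Compactness is needed only on the `Y` side. With values in `EReal`, the feasible set may be
  -- empty and the suprema infinite.
  have hminimax := Sion.minimax' hne (convex_convexHull ℝ _) hcompact
    (f := fun Y x => (saddleFunction B γ Y x : EReal)) (Y := dualFeasibleSet C A K)
    (fun x _ => (continuous_saddleFunction_left B γ x).lowerSemicontinuous.lowerSemicontinuousOn _)
    (fun x _ => quasiconvexOn_saddleFunction B γ k x) (convex_dualFeasibleSet C A K)
    (fun Y _ =>
      (continuous_saddleFunction_right B γ Y).upperSemicontinuous.upperSemicontinuousOn _)
    (fun Y hY => quasiconcaveOn_saddleFunction C A B K γ k hγ hY)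
  have hvalue (x : Matrix (Fin n) (Fin m) ℝ × Matrix (Fin l) (Fin m) ℝ) :
      ⨅ Y ∈ convexHull ℝ (projectionMatrices n k), (saddleFunction B γ Y x : EReal) =
        ((frobInner B x.2 -
          sumLargestEigenvalues (scaledGram_isHermitian γ x.1) k : ℝ) : EReal) := by
    rw [← sInf_image]
    exact (isLeast_saddleFunction B γ k hγ x).csInf_eq
  -- A supremum of continuous functions is lower semicontinuous, so the minimum over the compact
  -- hull is attained.
  obtain ⟨Y, hY, hmin⟩ := LowerSemicontinuousOn.exists_isMinOn hne hcompact
    (f := innerMax C A B K γ) (by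
      rw [hfun]
      exact lowerSemicontinuousOn_biSup fun x _ =>
        (continuous_saddleFunction_left B γ x).lowerSemicontinuous.lowerSemicontinuousOn _)
  have hleast : IsLeast (innerMax C A B K γ '' convexHull ℝ (projectionMatrices n k))
      (innerMax C A B K γ Y) :=
    ⟨⟨Y, hY, rfl⟩, by rintro _ ⟨Z, hZ, rfl⟩; exact hmin hZ⟩
  have hY' := hleast.csInf_eq
  rw [sInf_image, hfun, hminimax] at hY'
  rw [iSup_dualConjugate_sub C A B K]
  simp only [hvalue] at hY'
  rwa [hY', ← innerMax_eq_iSup_saddleFunction]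

end Minimax

theorem lemma11 {n m l : ℕ} (k : ℕ) (C : Matrix (Fin n) (Fin m) ℝ)
    (A : Matrix (Fin l) (Fin n) ℝ) (B : Matrix (Fin l) (Fin m) ℝ)
    (K : ProperCone ℝ (Matrix (Fin n) (Fin m) ℝ)) (γ : ℝ) (hγ : 0 < γ) :
    IsLeast (innerMax C A B K γ '' convexHull ℝ (projectionMatrices n k))
      (sdpValue C A B K γ k) ∧
    sdpValue C A B K γ k =
      ⨆ α : Matrix (Fin n) (Fin m) ℝ, dualConjugate C A B K α -
        ((sumLargestEigenvalues (scaledGram_isHermitian γ α) k : ℝ) : EReal) ∧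
    ∀ α : Matrix (Fin n) (Fin m) ℝ,
      IsLeast {v : ℝ | ∃ (U : Matrix (Fin n) (Fin n) ℝ) (t : ℝ),
          SDPFeasible γ α U t ∧ v = U.trace + (k : ℝ) * t}
        (sumLargestEigenvalues (scaledGram_isHermitian γ α) k) := by
  have hmin (α : Matrix (Fin n) (Fin m) ℝ) :
      IsLeast {v : ℝ | ∃ (U : Matrix (Fin n) (Fin n) ℝ) (t : ℝ),
          SDPFeasible γ α U t ∧ v = U.trace + (k : ℝ) * t}
        (sumLargestEigenvalues (scaledGram_isHermitian γ α) k) :=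
    isLeast_sumLargestEigenvalues _ k (posSemidef_scaledGram hγ.le α)
  have hsdp : sdpValue C A B K γ k =
      ⨆ α : Matrix (Fin n) (Fin m) ℝ, dualConjugate C A B K α -
        ((sumLargestEigenvalues (scaledGram_isHermitian γ α) k : ℝ) : EReal) := by
    -- For each `α`, the best `(U, t)` is the one attaining the minimum in `hmin`.
    refine iSup_congr fun α => le_antisymm ?_ ?_
    · refine iSup_le fun U => iSup_le fun t => iSup_le fun h => ?_
      exact EReal.sub_le_sub le_rfl (EReal.coe_le_coe_iff.2 ((hmin α).2 ⟨U, t, h, rfl⟩))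
    · obtain ⟨U, t, h, he⟩ := (hmin α).1
      rw [he]
      exact le_iSup_of_le U (le_iSup_of_le t (le_iSup_of_le h le_rfl))
  exact ⟨hsdp ▸ isLeast_innerMax C A B K γ k hγ.le, hsdp, hmin⟩
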